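/- **Theorem (Bounds on the Expected Runtime of CP Programs).** A *constant probability (CP) program* $\mathcal P$ over integer variables $\vec x=(x_1,\ldots,x_r)$, $r\ge 1$, is a loop $$\texttt{while }(\vec a\bullet\vec x>b)\ \{\ \vec x=\vec x+\vec c_1\,[p_1];\ \ldots;\ \vec x=\vec x+\vec c_n\,[p_n];\ \vec x=\vec d\,[p'];\ \}$$ with $\vec a,\vec c_1,\ldots,\vec c_n,\vec d\in\mathbb Z^r$, $b\in\mathbb Z$, the $\vec c_j$ pairwise distinct, $\vec a\bullet\vec d\le b$, and real constants $p_1,\ldots,p_n,p'\ge 0$ with $p_1+\cdots+p_n+p'=1$. In each iteration exactly one instruction is executed, chosen with the probability in brackets; a state violating the guard is never left. The expected runtime $rt^{\mathcal P}_{\vec x_0}\in[0,\infty]$ is the expected value, under the probability measure on infinite runs induced by $\mathcal P$ started in $\vec x_0$, of the first index $j$ at which the guard is violated ($\infty$ if there is none). $\mathcal P$ is *PAST* if $rt^{\mathcal P}_{\vec x_0}<\infty$ for all $\vec x_0\in\mathbb Z^r$; it has *direct termination* if $p'>0$ and some $\vec x\in\mathbb Z^r$ satisfies the guard. Let $\mathit{rdw}_{\mathcal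 P}(\vec z)=\vec a\bullet\vec z-b$, let $k_{\mathcal P},m_{\mathcal P}\in\mathbb N$ be minimal with $-k_{\mathcal P}\le\vec a\bullet\vec c_j\le m_{\mathcal P}$ for all $j$, and let $\mathcal P^{\mathit{rdw}}$ be the program with the single variable $x$ and guard $x>0$ which executes $x=x+j$ with probability $p^{\mathit{rdw}}_j=\sum_{u:\ \vec a\bullet\vec c_u=j}p_u$ for $-k_{\mathcal P}\le j\le m_{\mathcal P}$ and $x=\mathit{rdw}_{\mathcal P}(\vec d)$ with probability $p'$. Its drift is $\mu=\sum_{-k_{\mathcal P}\le j\le m_{\mathcal P}}j\cdot p^{\mathit{rdw}}_j$. $\mathcal P$ is *trivial* if $\vec a=\vec 0$ or $\mathcal P^{\mathit{rdw}}$ is $\texttt{while }(x>0)\ \{\ x=x\ [1];\ \}$. Let $\mathcal P$ be a non-trivial CP program without direct termination. Then $\mathcal P$ is PAST if and only if $\mu<0$. If this holds, then: 1. $rt^{\mathcal P}_{\vec x_0}=0$ for every $\vec x_0\in\mathbb Z^r$ with $\mathit{rdw}_{\mathcal P}(\vec x_0)\le 0$. 2. For every $\vec x_0\in\mathbb Z^r$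 with $\mathit{rdw}_{\mathcal P}(\vec x_0)>0$, $$-\tfrac1\mu\cdot\mathit{rdw}_{\mathcal P}(\vec x_0)\ \le\ rt^{\mathcal P}_{\vec x_0}\ \le\ -\tfrac1\mu\cdot\mathit{rdw}_{\mathcal P}(\vec x_0)+\tfrac{1-k_{\mathcal P}}{\mu}.$$ 3. The expected runtime is asymptotically linear: $rt^{\mathcal P}_{\vec x_0}\in\Theta(\mathit{rdw}_{\mathcal P}(\vec x_0))$ on $\{\vec x_0\in\mathbb Z^r\mid\mathit{rdw}_{\mathcal P}(\vec x_0)>0\}$, i.e. there are constants $C_1,C_2>0$ (depending on $\mathcal P$) with $C_1\,\mathit{rdw}_{\mathcal P}(\vec x_0)\le rt^{\mathcal P}_{\vec x_0}\le C_2\,\mathit{rdw}_{\mathcal P}(\vec x_0)$ for all these $\vec x_0$. -/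

import Mathlib

open MeasureTheory ProbabilityTheory Filter Asymptotics
open scoped ENNReal

noncomputable section

/-- Cylinder probabilities of a time-homogeneous Markov chain with kernel `κ` started in `x₀`. -/
lemma traj_cylinder {S : Type*} [MeasurableSpace S] [MeasurableSingletonClass S] [Countable S]
    [DecidableEq S] (κ : Kernel S S) (η : (i : ℕ) → Kernel (Finset.Iic i → S) S)
    [∀ i, IsMarkovKernel (η i)] (hη : ∀ i h, η i h = κ (h ⟨i, Finset.mem_Iic.2 le_rfl⟩))
    (x₀ : S) (z : ℕ → S) (n : ℕ) :
    Kernel.traj (X := fun _ => S) η 0 (fun _ => x₀) {ω | ∀ i ≤ n, ω i = z i}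
      = (if x₀ = z 0 then 1 else 0) * ∏ i ∈ Finset.range n, κ (z i) {z (i + 1)} := by
  have key : ∀ n : ℕ, {ω : ℕ → S | ∀ i ≤ n, ω i = z i}
      = Preorder.frestrictLe (π := fun _ => S) n ⁻¹' {fun i : Finset.Iic n => z (i : ℕ)} := by
    intro n
    ext ω
    exact ⟨fun hω => funext fun i => hω i (Finset.mem_Iic.1 i.2),
      fun ha i hi => congrFun ha ⟨i, Finset.mem_Iic.2 hi⟩⟩
  have hms : ∀ n : ℕ, MeasurableSet ({fun i : Finset.Iic n => z (i : ℕ)} : Set (Finset.Iic n → S)) :=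
    fun n => measurableSet_singleton _
  induction n with
  | zero =>
    rw [key, ← Measure.map_apply (by fun_prop) (hms 0), Kernel.traj_map_frestrictLe_apply,
      Kernel.partialTraj_self, Kernel.id_apply, Measure.dirac_apply' _ (hms 0)]
    by_cases h : x₀ = z 0
    · have : (fun _ => x₀ : Finset.Iic 0 → S) = fun i : Finset.Iic 0 => z i := by
        funext i
        have : (i : ℕ) = 0 := Nat.le_zero.1 (Finset.mem_Iic.1 i.2)
        rw [this, h]
      rw [this]; simp [h]
    · have : (fun _ => x₀ : Finset.Iic 0 → S) ≠ fun i : Finset.Iic 0 => z i := fun e =>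
        h (congrFun e ⟨0, Finset.mem_Iic.2 le_rfl⟩)
      simp [h, this]
  | succ n ih =>
    have h := Kernel.partialTraj_compProd_eq_map_traj (X := fun _ => S) (κ := η)
      (Nat.zero_le n) (x₀ := fun _ => x₀)
    have h2 := congrArg (fun μ => μ ({fun i : Finset.Iic n => z (i : ℕ)} ×ˢ {z (n + 1)})) h
    beta_reduce at h2
    rw [Measure.compProd_apply_prod (hms n) (measurableSet_singleton _),
      lintegral_singleton, ← Kernel.traj_map_frestrictLe_apply,
      Measure.map_apply (by fun_prop) (hms n),
      Measure.map_apply (by fun_prop) ((hms n).prod (measurableSet_singleton _)), ← key, ih,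
      hη] at h2
    have e1 : (fun ω : ℕ → S => (Preorder.frestrictLe (π := fun _ => S) n ω, ω (n + 1))) ⁻¹'
        ({fun i : Finset.Iic n => z (i : ℕ)} ×ˢ {z (n + 1)}) = {ω | ∀ i ≤ n + 1, ω i = z i} := by
      ext ω
      constructor
      · rintro ⟨ha, hb⟩ i hi
        rcases Nat.lt_or_eq_of_le hi with hi | rfl
        · exact congrFun ha ⟨i, Finset.mem_Iic.2 (Nat.lt_succ_iff.1 hi)⟩
        · exact hb
      · intro hω
        exact ⟨funext fun i => hω i ((Finset.mem_Iic.1 i.2).trans (Nat.le_succ n)),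
          hω _ le_rfl⟩
    rw [e1] at h2
    rw [← h2, Finset.prod_range_succ]
    ring

/-- A probabilistic program over the integer variables `x = (x₁, …, x_r)`:
`while (a • x > b) { x = x + c₁ [p₁(x)]; …; x = x + cₙ [pₙ(x)]; x = d [p'(x)]; }`. -/
structure ProbProgram (r : ℕ) where
  one_le_r : 1 ≤ r
  /-- number of instructions of the form `x = x + c_j` -/
  n : ℕ
  a : Fin r → ℤ
  b : ℤ
  c : Fin n → Fin r → ℤ
  c_injective : Function.Injective c
  d : Fin r → ℤ
  d_violates : a ⬝ᵥ d ≤ b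
  p : Fin n → (Fin r → ℤ) → ℝ
  /-- probability `p'` of direct termination -/
  p' : (Fin r → ℤ) → ℝ
  p_nonneg : ∀ j x, 0 ≤ p j x
  p'_nonneg : ∀ x, 0 ≤ p' x
  sum_eq_one : ∀ x, ∑ j, p j x + p' x = 1

namespace ProbProgram

variable {r : ℕ} (P : ProbProgram r)

/-- The loop guard `a • x > b`. -/
def Guard (x : Fin r → ℤ) : Prop := P.b < P.a ⬝ᵥ x

/-- The program has direct termination: `p'(x) > 0` for some `x` satisfying the loop guard. -/
def DirectTermination : Prop := ∃ x, P.Guard x ∧ 0 < P.p' x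

open Classical in
/-- The distribution of the next state if the current state is `z`. A state that violates the
loop guard is never left. -/
def step (z : Fin r → ℤ) : Measure (Fin r → ℤ) :=
  if P.Guard z then
    ∑ j, ENNReal.ofReal (P.p j z) • Measure.dirac (z + P.c j)
      + ENNReal.ofReal (P.p' z) • Measure.dirac P.d
  else Measure.dirac z

instance (z : Fin r → ℤ) : IsProbabilityMeasure (P.step z) := by
  constructor
  unfold step
  split_ifs
  · simp only [Measure.add_apply, Measure.finsetSum_apply, Measure.smul_apply, measure_univ,
      smul_eq_mul, mul_one]
    rw [← ENNReal.ofReal_sum_of_nonneg fun j _ => P.p_nonneg j z,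
      ← ENNReal.ofReal_add (Finset.sum_nonneg fun j _ => P.p_nonneg j z) (P.p'_nonneg z),
      P.sum_eq_one, ENNReal.ofReal_one]
  · simp

/-- The transition kernel of the Markov chain of program states. -/
def stepKernel : Kernel (Fin r → ℤ) (Fin r → ℤ) := Kernel.ofFunOfCountable P.step

instance : IsMarkovKernel P.stepKernel :=
  ⟨fun z => inferInstanceAs (IsProbabilityMeasure (P.step z))⟩

/-- The next state as a function of the history `z₀, …, z_i`; only `z_i` matters. -/
def historyKernel (i : ℕ) : Kernel (Finset.Iic i → (Fin r → ℤ)) (Fin r → ℤ) :=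
  P.stepKernel.comap (fun h => h ⟨i, Finset.mem_Iic.2 le_rfl⟩) (measurable_pi_apply _)

instance (i : ℕ) : IsMarkovKernel (P.historyKernel i) := by
  unfold historyKernel
  infer_instance

/-- The probability measure on infinite runs `⟨z₀, z₁, …⟩` induced by the program when it is started
in `x₀`. -/
def runMeasure (x₀ : Fin r → ℤ) : Measure (ℕ → (Fin r → ℤ)) :=
  Kernel.traj (X := fun _ => (Fin r → ℤ)) P.historyKernel 0 (fun _ => x₀)

instance (x₀ : Fin r → ℤ) : IsProbabilityMeasure (P.runMeasure x₀) := by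
  unfold runMeasure
  infer_instance

/-- The probability of a cylinder set is the product of the one-step probabilities; this determines
`runMeasure` uniquely. -/
lemma runMeasure_cylinder (x₀ : Fin r → ℤ) (z : ℕ → (Fin r → ℤ)) (n : ℕ) :
    P.runMeasure x₀ {ω | ∀ i ≤ n, ω i = z i}
      = (if x₀ = z 0 then 1 else 0) * ∏ i ∈ Finset.range n, P.step (z i) {z (i + 1)} :=
  traj_cylinder P.stepKernel P.historyKernel (fun _ _ => rfl) x₀ z n

/-- The termination time of a run: the first index whose state violates the loop guard,
or `∞` if there is none. -/
def terminationTime (ω : ℕ → (Fin r → ℤ)) : ℕ∞ := ⨅ (j : ℕ) (_ : ¬ P.Guard (ω j)), (j : ℕ∞)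

/-- The expected runtime: the expected value of the termination time. -/
def rt (x₀ : Fin r → ℤ) : ℝ≥0∞ := ∫⁻ ω, (P.terminationTime ω : ℝ≥0∞) ∂(P.runMeasure x₀)

/-- Positive almost sure termination: the expected runtime is finite for every initial value. -/
def IsPAST : Prop := ∀ x₀, P.rt x₀ < ∞

end ProbProgram

/-- A random walk program, i.e., a one-variable program
`while (x > 0) { x = x + m [p_m]; …; x = x [p_0]; …; x = x - k [p_{-k}]; x = d [p']; }`
with `d ≤ 0`. Only the values `p j` with `-k ≤ j ≤ m` belong to the program. -/
structure RandomWalkProgram where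
  m : ℕ
  k : ℕ
  d : ℤ
  d_nonpos : d ≤ 0
  p : ℤ → ℝ
  p' : ℝ
  p_nonneg : ∀ j ∈ Finset.Icc (-(k : ℤ)) m, 0 ≤ p j
  p'_nonneg : 0 ≤ p'
  sum_eq_one : ∑ j ∈ Finset.Icc (-(k : ℤ)) m, p j + p' = 1

namespace RandomWalkProgram

/-- The drift `∑_{-k ≤ j ≤ m} j * p_j`. -/
def drift (Q : RandomWalkProgram) : ℝ := ∑ j ∈ Finset.Icc (-(Q.k : ℤ)) Q.m, (j : ℝ) * Q.p j

/-- The program is `while (x > 0) { x = x [1]; }`. -/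
def IsLoopForever (Q : RandomWalkProgram) : Prop := Q.m = 0 ∧ Q.k = 0 ∧ Q.p 0 = 1

end RandomWalkProgram

/-- A constant probability (CP) program: a probabilistic program whose probabilities do not depend
on the values of the variables. -/
structure CPProgram (r : ℕ) where
  one_le_r : 1 ≤ r
  n : ℕ
  a : Fin r → ℤ
  b : ℤ
  c : Fin n → Fin r → ℤ
  c_injective : Function.Injective c
  d : Fin r → ℤ
  d_violates : a ⬝ᵥ d ≤ b
  p : Fin n → ℝ
  p' : ℝ
  p_nonneg : ∀ j, 0 ≤ p j
  p'_nonneg : 0 ≤ p'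
  sum_eq_one : ∑ j, p j + p' = 1

namespace CPProgram

variable {r : ℕ} (P : CPProgram r)

def toProbProgram : ProbProgram r where
  one_le_r := P.one_le_r
  n := P.n
  a := P.a
  b := P.b
  c := P.c
  c_injective := P.c_injective
  d := P.d
  d_violates := P.d_violates
  p := fun j _ => P.p j
  p' := fun _ => P.p'
  p_nonneg := fun j _ => P.p_nonneg j
  p'_nonneg := fun _ => P.p'_nonneg
  sum_eq_one := fun _ => P.sum_eq_one

/-- The affine map `z ↦ a • z - b`. -/
def rdwMap (z : Fin r → ℤ) : ℤ := P.a ⬝ᵥ z - P.b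

/-- The minimal `k ∈ ℕ` with `-k ≤ a • c_j` for all `j`. -/
def k : ℕ := sInf {k : ℕ | ∀ j, -(k : ℤ) ≤ P.a ⬝ᵥ P.c j}

/-- The minimal `m ∈ ℕ` with `a • c_j ≤ m` for all `j`. -/
def m : ℕ := sInf {m : ℕ | ∀ j, P.a ⬝ᵥ P.c j ≤ (m : ℤ)}

lemma neg_k_le (j : Fin P.n) : -(P.k : ℤ) ≤ P.a ⬝ᵥ P.c j := by
  have h : {k : ℕ | ∀ j, -(k : ℤ) ≤ P.a ⬝ᵥ P.c j}.Nonempty := by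
    refine ⟨∑ j, (P.a ⬝ᵥ P.c j).natAbs, fun j => ?_⟩
    have := Finset.single_le_sum (f := fun j => (P.a ⬝ᵥ P.c j).natAbs)
      (fun _ _ => Nat.zero_le _) (Finset.mem_univ j)
    omega
  exact Nat.sInf_mem h j

lemma le_m (j : Fin P.n) : P.a ⬝ᵥ P.c j ≤ (P.m : ℤ) := by
  have h : {m : ℕ | ∀ j, P.a ⬝ᵥ P.c j ≤ (m : ℤ)}.Nonempty := by
    refine ⟨∑ j, (P.a ⬝ᵥ P.c j).natAbs, fun j => ?_⟩
    have := Finset.single_le_sum (f := fun j => (P.a ⬝ᵥ P.c j).natAbs)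
      (fun _ _ => Nat.zero_le _) (Finset.mem_univ j)
    omega
  exact Nat.sInf_mem h j

/-- The random walk program obtained by replacing `x` by the single variable `a • x - b`: the
probability of the change `j` is the sum of all `p_u` with `a • c_u = j`. -/
def rdw : RandomWalkProgram where
  m := P.m
  k := P.k
  d := P.rdwMap P.d
  d_nonpos := sub_nonpos.2 P.d_violates
  p := fun j => ∑ u with P.a ⬝ᵥ P.c u = j, P.p u
  p' := P.p'
  p_nonneg := fun _ _ => Finset.sum_nonneg fun u _ => P.p_nonneg u
  p'_nonneg := P.p'_nonneg
  sum_eq_one := by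
    rw [Finset.sum_fiberwise_of_maps_to
      (fun u _ => Finset.mem_Icc.2 ⟨P.neg_k_le u, P.le_m u⟩) P.p, P.sum_eq_one]

/-- A CP program is trivial if `a = 0` or its random walk program is
`while (x > 0) { x = x [1]; }`. -/
def IsTrivial : Prop := P.a = 0 ∨ P.rdw.IsLoopForever

end CPProgram

end

/-!
For a run `ω` let `M n = a • ω n - b`, so that the guard holds at time `n` exactly if `0 < M n`, and
let `T` be the termination time. Since `P` is not trivial, `a ≠ 0`; hence some state satisfies the
guard, and the absence of direct termination means `p' = 0`. Consequently every step taken from a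
state satisfying the guard changes `M` by some `a • c_j`, whose expectation is the drift `μ`, and
violating states are absorbing. Write `x` for the initial value of `M`, and assume `0 < x`.

* Absorption gives `T > n ↔ 0 < M n` almost surely, so `E T = ∑ n, P(0 < M n)`
  (`ProbProgram.rt_eq_tsum_survival`).
* The Markov property (`ProbProgram.map_pair_runMeasure`) gives Wald's identity
  `E (M N) = x + μ * ∑ n < N, P(0 < M n)` (`CPProgram.integral_rdwMap_eval`).
* A step starts at `M ≥ 1` and lowers `M` by at most `k`, so `1 - k ≤ M N`. For `μ < 0` this bounds
  the partial sums of `E T` and yields the upper bound (`CPProgram.rt_le`).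
* On the other hand `M N ≤ x + m * N`, and `M N ≤ 0` once the guard fails, so
  `E (M N) ≤ (x + m * N) * P(0 < M N)`. If the left-hand side were at least some `δ > 0` for all
  `N`, then `P(0 < M N)` would dominate a multiple of the harmonic series and `E T` would be infinite
  (`CPProgram.rt_eq_top_of_le`). For `μ ≥ 0` this applies with `δ = x`, so the program is not PAST.
  For `μ < 0` it applies with `δ = x + μ * E T` if that number is positive; as `E T` is finite, it
  cannot be, which is the lower bound (`CPProgram.le_rt`).

Asymptotic linearity follows from the two bounds because `x` is an integer, so that `x ≥ 1` absorbs
the constant term of the upper bound.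
-/

/-! ### The Markov property of the run measure -/

namespace ProbProgram

variable {r : ℕ} (P : ProbProgram r)

lemma measurable_eval (n : ℕ) : Measurable fun ω : ℕ → (Fin r → ℤ) => ω n :=
  measurable_pi_apply n

lemma measurable_eval_pair (n : ℕ) : Measurable fun ω : ℕ → (Fin r → ℤ) => (ω n, ω (n + 1)) :=
  (measurable_eval n).prodMk (measurable_eval (n + 1))

instance (x₀ : Fin r → ℤ) (n : ℕ) :
    IsProbabilityMeasure ((P.runMeasure x₀).map (fun ω => ω n)) :=
  Measure.isProbabilityMeasure_map (measurable_eval n).aemeasurable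

/-- Two consecutive states of a run: the first one has the law of `ω n`, the second one is drawn
from the step distribution. This is the Markov property in the only form that is needed. -/
lemma map_pair_runMeasure (x₀ : Fin r → ℤ) (n : ℕ) :
    (P.runMeasure x₀).map (fun ω => (ω n, ω (n + 1)))
      = (P.runMeasure x₀).map (fun ω => ω n) ⊗ₘ P.stepKernel := by
  have h := Kernel.partialTraj_compProd_eq_map_traj (X := fun _ => (Fin r → ℤ))
    (κ := P.historyKernel) (Nat.zero_le n) (x₀ := fun _ => x₀)
  rw [← Kernel.traj_map_frestrictLe_apply] at h
  have hlast : Measurable fun g : Finset.Iic n → (Fin r → ℤ) => g ⟨n, Finset.mem_Iic.2 le_rfl⟩ :=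
    measurable_pi_apply _
  have h1 : (P.runMeasure x₀).map (fun ω => (ω n, ω (n + 1)))
      = ((P.runMeasure x₀).map (fun ω => (Preorder.frestrictLe n ω, ω (n + 1)))).map
          (Prod.map (fun g : Finset.Iic n → (Fin r → ℤ) => g ⟨n, Finset.mem_Iic.2 le_rfl⟩) id) := by
    rw [Measure.map_map (by fun_prop) (by fun_prop)]
    rfl
  have h2 : (P.runMeasure x₀).map (fun ω => ω n)
      = ((P.runMeasure x₀).map (Preorder.frestrictLe n)).map
          (fun g : Finset.Iic n → (Fin r → ℤ) => g ⟨n, Finset.mem_Iic.2 le_rfl⟩) := by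
    rw [Measure.map_map (by fun_prop) (by fun_prop)]
    rfl
  have : IsProbabilityMeasure ((P.runMeasure x₀).map
      (Preorder.frestrictLe (π := fun _ => (Fin r → ℤ)) n)) :=
    Measure.isProbabilityMeasure_map (by fun_prop)
  rw [h1]
  change (P.runMeasure x₀).map (Preorder.frestrictLe n) ⊗ₘ P.historyKernel n
    = (P.runMeasure x₀).map (fun ω => (Preorder.frestrictLe n ω, ω (n + 1))) at h
  rw [← h]
  ext s hs
  rw [Measure.map_apply (by fun_prop) hs, Measure.compProd_apply (by measurability),
    Measure.compProd_apply hs, h2, lintegral_map _ hlast]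
  · rfl
  · exact Kernel.measurable_kernel_prodMk_left hs

lemma ae_runMeasure_zero (x₀ : Fin r → ℤ) : ∀ᵐ ω ∂P.runMeasure x₀, ω 0 = x₀ := by
  have h := P.runMeasure_cylinder x₀ (fun _ => x₀) 0
  simp only [if_true, Finset.range_zero, Finset.prod_empty, mul_one, nonpos_iff_eq_zero,
    forall_eq] at h
  exact (mem_ae_iff_prob_eq_one (measurable_eval 0 (measurableSet_singleton x₀))).2 h

/-- A relation that the step distribution satisfies almost surely in every state holds almost
surely along the whole run. -/
lemma ae_runMeasure_step (x₀ : Fin r → ℤ) {R : (Fin r → ℤ) → (Fin r → ℤ) → Prop}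
    (hR : ∀ z, ∀ᵐ y ∂P.step z, R z y) :
    ∀ᵐ ω ∂P.runMeasure x₀, ∀ n, R (ω n) (ω (n + 1)) := by
  refine ae_all_iff.2 fun n => ?_
  have h : ∀ᵐ q ∂(P.runMeasure x₀).map (fun ω => (ω n, ω (n + 1))), R q.1 q.2 := by
    rw [map_pair_runMeasure]
    exact Measure.ae_compProd_of_ae_ae (MeasurableSet.of_discrete) (ae_of_all _ hR)
  exact ae_of_ae_map (measurable_eval_pair n).aemeasurable h

/-- Conditioning on the current state. -/
lemma integral_runMeasure_pair (x₀ : Fin r → ℤ) (n : ℕ) {f : (Fin r → ℤ) × (Fin r → ℤ) → ℝ}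
    (hf : Integrable (fun ω => f (ω n, ω (n + 1))) (P.runMeasure x₀)) :
    ∫ ω, f (ω n, ω (n + 1)) ∂P.runMeasure x₀
      = ∫ ω, ∫ y, f (ω n, y) ∂P.step (ω n) ∂P.runMeasure x₀ := by
  have hfm : Measurable f := measurable_of_countable f
  have hpair := integral_map (μ := P.runMeasure x₀) (measurable_eval_pair n).aemeasurable
    hfm.aestronglyMeasurable
  rw [← hpair, map_pair_runMeasure, Measure.integral_compProd]
  · exact integral_map (f := fun z => ∫ y, f (z, y) ∂P.stepKernel z)
      (measurable_eval n).aemeasurable (measurable_of_countable _).aestronglyMeasurable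
  · rw [← map_pair_runMeasure]
    exact (integrable_map_measure hfm.aestronglyMeasurable
      (measurable_eval_pair n).aemeasurable).2 hf

/-! ### The expected runtime as a sum of survival probabilities -/

lemma measurableSet_guard (n : ℕ) :
    MeasurableSet {ω : ℕ → (Fin r → ℤ) | P.Guard (ω n)} :=
  measurable_eval n (MeasurableSet.of_discrete (s := {z | P.Guard z}))

/-- The probability that the loop is still running at time `n`. As violating states are never left,
it is enough to look at the state at time `n`. -/
noncomputable def survival (x₀ : Fin r → ℤ) (n : ℕ) : ℝ :=
  (P.runMeasure x₀).real {ω | P.Guard (ω n)}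

lemma survival_nonneg (x₀ : Fin r → ℤ) (n : ℕ) : 0 ≤ P.survival x₀ n := measureReal_nonneg

lemma ae_step_of_not_guard (z : Fin r → ℤ) : ∀ᵐ y ∂P.step z, ¬ P.Guard z → y = z := by
  by_cases hz : P.Guard z
  · simp [hz]
  · simp [step, hz]

open Classical in
/-- On a run on which violating states are never left, the termination time counts the indices
whose state satisfies the guard. -/
lemma terminationTime_eq_tsum {ω : ℕ → (Fin r → ℤ)}
    (hω : ∀ n, ¬ P.Guard (ω n) → ω (n + 1) = ω n) :
    (P.terminationTime ω : ℝ≥0∞) = ∑' n, if P.Guard (ω n) then 1 else 0 := by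
  by_cases h : ∃ n, ¬ P.Guard (ω n)
  · have hN := Nat.find_spec h
    have hmin : ∀ n < Nat.find h, P.Guard (ω n) := fun n hn => not_not.1 (Nat.find_min h hn)
    set N := Nat.find h
    have hstay : ∀ n, N ≤ n → ¬ P.Guard (ω n) := by
      intro n hn
      induction n, hn using Nat.le_induction with
      | base => exact hN
      | succ n _ ih => rwa [hω n ih]
    have hT : P.terminationTime ω = N := by
      refine le_antisymm (iInf₂_le N hN) (le_iInf₂ fun j hj => ?_)
      by_contra! hlt
      exact hj (hmin j (by exact_mod_cast hlt))
    rw [hT, tsum_eq_sum (s := Finset.range N)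
      (fun n hn => if_neg (hstay n (by simpa using hn))),
      Finset.sum_congr rfl (fun n hn => if_pos (hmin n (Finset.mem_range.1 hn)))]
    simp
  · push Not at h
    have hT : P.terminationTime ω = ⊤ := by simp [terminationTime, h]
    simp [hT, h]

lemma rt_eq_tsum_survival (x₀ : Fin r → ℤ) :
    P.rt x₀ = ∑' n, ENNReal.ofReal (P.survival x₀ n) := by
  classical
  have h : ∀ᵐ ω ∂P.runMeasure x₀, (P.terminationTime ω : ℝ≥0∞)
      = ∑' n, if P.Guard (ω n) then 1 else 0 := by
    filter_upwards [P.ae_runMeasure_step x₀ P.ae_step_of_not_guard] with ω hω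
    exact P.terminationTime_eq_tsum hω
  rw [rt, lintegral_congr_ae h, lintegral_tsum fun n =>
    (Measurable.ite (P.measurableSet_guard n) measurable_const measurable_const).aemeasurable]
  congr 1
  funext n
  rw [survival, ofReal_measureReal, ← lintegral_indicator_one (P.measurableSet_guard n)]
  rfl

lemma rt_eq_zero {x₀ : Fin r → ℤ} (h : ¬ P.Guard x₀) : P.rt x₀ = 0 := by
  have h0 : ∀ᵐ ω ∂P.runMeasure x₀, (P.terminationTime ω : ℝ≥0∞) = 0 := by
    filter_upwards [P.ae_runMeasure_zero x₀] with ω hω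
    have : P.terminationTime ω ≤ (0 : ℕ) := iInf₂_le 0 (by rwa [hω])
    simp [nonpos_iff_eq_zero.1 this]
  rw [rt, lintegral_congr_ae h0, lintegral_zero]

/-- The expected runtime is the sum of the survival probabilities, so it is infinite if these
dominate a multiple of the harmonic series. -/
lemma rt_eq_top_of_le_mul_survival {x₀ : Fin r → ℤ} {A B δ : ℝ} (hA : 0 ≤ A) (hB : 0 ≤ B)
    (hδ : 0 < δ) (h : ∀ n : ℕ, δ ≤ (A + B * n) * P.survival x₀ n) : P.rt x₀ = ⊤ := by
  by_contra hne
  rw [rt_eq_tsum_survival] at hne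
  have hs := ENNReal.summable_toReal hne
  simp only [ENNReal.toReal_ofReal (P.survival_nonneg x₀ _)] at hs
  refine Real.not_summable_one_div_natCast ((summable_nat_add_iff 1).1 ?_)
  refine Summable.of_nonneg_of_le (fun n => by positivity) (fun n => ?_)
    (hs.mul_left ((A + B) / δ))
  have hn : (0 : ℝ) ≤ n := n.cast_nonneg
  have hle : A + B * n ≤ (A + B) * ((n + 1 : ℕ) : ℝ) := by push_cast; nlinarith
  have h2 := (h n).trans (mul_le_mul_of_nonneg_right hle (P.survival_nonneg x₀ n))
  rw [div_mul_eq_mul_div, div_le_div_iff₀ (by positivity) hδ]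
  linarith

end ProbProgram

/-! ### One step of a constant probability program -/

namespace CPProgram

variable {r : ℕ} (P : CPProgram r)

lemma guard_iff (z : Fin r → ℤ) : P.toProbProgram.Guard z ↔ 0 < P.rdwMap z :=
  sub_pos.symm

lemma rdwMap_add (z c : Fin r → ℤ) : P.rdwMap (z + c) = P.rdwMap z + P.a ⬝ᵥ c := by
  simp only [rdwMap, dotProduct_add]
  ring

lemma exists_rdwMap_pos (ha : P.a ≠ 0) : ∃ z, 0 < P.rdwMap z := by
  obtain ⟨i, hi⟩ := Function.ne_iff.1 ha
  refine ⟨Pi.single i (P.a i * (|P.b| + 1)), ?_⟩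
  have h1 : 0 < P.a i * P.a i := mul_self_pos.2 hi
  rw [rdwMap, dotProduct_single]
  nlinarith [le_abs_self P.b, abs_nonneg P.b]

lemma p'_eq_zero (ha : P.a ≠ 0) (hdirect : ¬ P.toProbProgram.DirectTermination) : P.p' = 0 := by
  obtain ⟨z, hz⟩ := P.exists_rdwMap_pos ha
  by_contra hne
  exact hdirect ⟨z, (P.guard_iff z).2 hz, lt_of_le_of_ne P.p'_nonneg (Ne.symm hne)⟩

lemma drift_eq_sum : P.rdw.drift = ∑ u, ((P.a ⬝ᵥ P.c u : ℤ) : ℝ) * P.p u := by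
  rw [← Finset.sum_fiberwise_of_maps_to (t := Finset.Icc (-(P.k : ℤ)) P.m)
    (fun u _ => Finset.mem_Icc.2 ⟨P.neg_k_le u, P.le_m u⟩)]
  refine Finset.sum_congr rfl fun j _ => ?_
  change (j : ℝ) * ∑ u with P.a ⬝ᵥ P.c u = j, P.p u = _
  rw [Finset.mul_sum]
  refine Finset.sum_congr rfl fun u hu => ?_
  rw [(Finset.mem_filter.1 hu).2]

lemma ae_step_of_guard (hp : P.p' = 0) (z : Fin r → ℤ) :
    ∀ᵐ y ∂P.toProbProgram.step z, P.toProbProgram.Guard z → ∃ j, y = z + P.c j := by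
  by_cases hz : P.toProbProgram.Guard z
  · simp only [hz, forall_const, ProbProgram.step, if_true]
    have h0 : P.toProbProgram.p' z = 0 := hp
    rw [h0, ENNReal.ofReal_zero, zero_smul, add_zero, ae_iff, Measure.finsetSum_apply]
    refine Finset.sum_eq_zero fun j _ => ?_
    rw [Measure.smul_apply, Measure.dirac_apply' _ MeasurableSet.of_discrete,
      Set.indicator_of_notMem (by simpa using ⟨j, rfl⟩), smul_zero]
  · simp [hz]

open Classical in
/-- The expected change of `a • x - b` in one step is the drift while the guard holds, and `0`
afterwards. -/
lemma integral_step_sub (hp : P.p' = 0) (z : Fin r → ℤ) :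
    ∫ y, ((P.rdwMap y : ℝ) - P.rdwMap z) ∂P.toProbProgram.step z
      = if P.toProbProgram.Guard z then P.rdw.drift else 0 := by
  unfold ProbProgram.step
  split_ifs with hz
  · have h0 : P.toProbProgram.p' z = 0 := hp
    rw [h0, ENNReal.ofReal_zero, zero_smul, add_zero, drift_eq_sum,
      integral_finsetSum_measure fun j _ =>
        (integrable_dirac (by simp)).smul_measure ENNReal.ofReal_ne_top]
    refine Finset.sum_congr rfl fun j _ => ?_
    have hj : (ENNReal.ofReal (P.toProbProgram.p j z)).toReal = P.p j :=
      ENNReal.toReal_ofReal (P.p_nonneg j)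
    rw [integral_smul_measure, integral_dirac, hj]
    change P.p j • ((P.rdwMap (z + P.c j) : ℝ) - P.rdwMap z) = _
    rw [rdwMap_add]
    push_cast
    simp only [smul_eq_mul]
    ring
  · simp

/-! ### Wald's identity for `a • x - b` -/

/-- The run-wise facts about the value `a • x - b` when no direct termination takes place: it stays
above `-k`, because the last step that decreases it starts from a positive value, and it exceeds its
initial value by at most `m` per step. -/
lemma ae_rdwMap_bounds (hp : P.p' = 0) {x₀ : Fin r → ℤ} (hx : 0 < P.rdwMap x₀) :
    ∀ᵐ ω ∂P.toProbProgram.runMeasure x₀, ∀ n : ℕ,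
      1 - (P.k : ℤ) ≤ P.rdwMap (ω n) ∧ P.rdwMap (ω n) ≤ P.rdwMap x₀ + P.m * n := by
  filter_upwards [P.toProbProgram.ae_runMeasure_zero x₀,
    P.toProbProgram.ae_runMeasure_step x₀ P.toProbProgram.ae_step_of_not_guard,
    P.toProbProgram.ae_runMeasure_step x₀ (P.ae_step_of_guard hp)] with ω h0 hstay hmove
  have hstep : ∀ n : ℕ, (P.rdwMap (ω (n + 1)) = P.rdwMap (ω n)) ∨
      (0 < P.rdwMap (ω n) ∧ -(P.k : ℤ) ≤ P.rdwMap (ω (n + 1)) - P.rdwMap (ω n) ∧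
        P.rdwMap (ω (n + 1)) - P.rdwMap (ω n) ≤ P.m) := by
    intro n
    by_cases hg : P.toProbProgram.Guard (ω n)
    · obtain ⟨j, hj⟩ := hmove n hg
      right
      rw [hj, rdwMap_add, add_sub_cancel_left]
      exact ⟨(P.guard_iff _).1 hg, P.neg_k_le j, P.le_m j⟩
    · left
      rw [hstay n hg]
  intro n
  refine ⟨?_, ?_⟩
  · induction n with
    | zero => rw [h0]; omega
    | succ n ih => rcases hstep n with h | h <;> omega
  · induction n with
    | zero => rw [h0]; simp
    | succ n ih =>
      have : (P.m : ℤ) * ((n + 1 : ℕ) : ℤ) = P.m * n + P.m := by push_cast; ring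
      rcases hstep n with h | h <;> omega

lemma integrable_rdwMap_eval (hp : P.p' = 0) {x₀ : Fin r → ℤ} (hx : 0 < P.rdwMap x₀) (n : ℕ) :
    Integrable (fun ω => (P.rdwMap (ω n) : ℝ)) (P.toProbProgram.runMeasure x₀) := by
  have hm : Measurable fun ω : ℕ → (Fin r → ℤ) => (P.rdwMap (ω n) : ℝ) :=
    (measurable_of_countable fun z : Fin r → ℤ => (P.rdwMap z : ℝ)).comp (measurable_pi_apply n)
  refine Integrable.of_mem_Icc (1 - (P.k : ℝ)) (P.rdwMap x₀ + P.m * n) hm.aemeasurable ?_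
  filter_upwards [P.ae_rdwMap_bounds hp hx] with ω hω
  obtain ⟨h1, h2⟩ := hω n
  exact ⟨by exact_mod_cast h1, by exact_mod_cast h2⟩

/-- Optional stopping at the time `min T N`, in Wald's form: the expected value of `a • x - b` after
`N` steps is its initial value plus the drift times the expectation of `min T N`. -/
lemma integral_rdwMap_eval (hp : P.p' = 0) {x₀ : Fin r → ℤ} (hx : 0 < P.rdwMap x₀) (N : ℕ) :
    ∫ ω, (P.rdwMap (ω N) : ℝ) ∂P.toProbProgram.runMeasure x₀
      = P.rdwMap x₀ + P.rdw.drift * ∑ n ∈ Finset.range N, P.toProbProgram.survival x₀ n := by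
  classical
  induction N with
  | zero =>
    have h : ∀ᵐ ω ∂P.toProbProgram.runMeasure x₀, (P.rdwMap (ω 0) : ℝ) = P.rdwMap x₀ := by
      filter_upwards [P.toProbProgram.ae_runMeasure_zero x₀] with ω hω
      rw [hω]
    simp [integral_congr_ae h]
  | succ N ih =>
    have h1 := P.integrable_rdwMap_eval hp hx (N + 1)
    have h2 := P.integrable_rdwMap_eval hp hx N
    have hpair := P.toProbProgram.integral_runMeasure_pair x₀ N
      (f := fun q => (P.rdwMap q.2 : ℝ) - P.rdwMap q.1) (h1.sub h2)
    simp only [P.integral_step_sub hp] at hpair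
    rw [integral_sub h1 h2, ih] at hpair
    have hind : ∫ ω, (if P.toProbProgram.Guard (ω N) then P.rdw.drift else 0)
        ∂P.toProbProgram.runMeasure x₀ = P.rdw.drift * P.toProbProgram.survival x₀ N := by
      have := integral_indicator_const (μ := P.toProbProgram.runMeasure x₀) P.rdw.drift
        (P.toProbProgram.measurableSet_guard N)
      rw [smul_eq_mul, mul_comm] at this
      exact this
    rw [hind] at hpair
    rw [Finset.sum_range_succ]
    linarith

/-! ### Bounds on the expected runtime -/

lemma le_rdwMap_add_drift_mul_sum (hp : P.p' = 0) {x₀ : Fin r → ℤ} (hx : 0 < P.rdwMap x₀)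
    (N : ℕ) :
    1 - (P.k : ℝ) ≤ P.rdwMap x₀
      + P.rdw.drift * ∑ n ∈ Finset.range N, P.toProbProgram.survival x₀ n := by
  rw [← P.integral_rdwMap_eval hp hx N]
  have h := integral_mono_ae (integrable_const (1 - (P.k : ℝ)))
    (P.integrable_rdwMap_eval hp hx N) (by
      filter_upwards [P.ae_rdwMap_bounds hp hx] with ω hω
      exact_mod_cast (hω N).1)
  simpa using h

lemma rdwMap_add_drift_mul_sum_le (hp : P.p' = 0) {x₀ : Fin r → ℤ} (hx : 0 < P.rdwMap x₀)
    (N : ℕ) :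
    P.rdwMap x₀ + P.rdw.drift * ∑ n ∈ Finset.range N, P.toProbProgram.survival x₀ n
      ≤ (P.rdwMap x₀ + P.m * N) * P.toProbProgram.survival x₀ N := by
  rw [← P.integral_rdwMap_eval hp hx N]
  have hind := integral_indicator_const (μ := P.toProbProgram.runMeasure x₀)
    ((P.rdwMap x₀ : ℝ) + P.m * N) (P.toProbProgram.measurableSet_guard N)
  rw [smul_eq_mul, mul_comm (Measure.real _ _)] at hind
  rw [ProbProgram.survival, ← hind]
  refine integral_mono_ae (P.integrable_rdwMap_eval hp hx N)
    ((integrable_const _).indicator (P.toProbProgram.measurableSet_guard N)) ?_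
  filter_upwards [P.ae_rdwMap_bounds hp hx] with ω hω
  by_cases hg : P.toProbProgram.Guard (ω N)
  · rw [Set.indicator_of_mem (show ω ∈ {ω | P.toProbProgram.Guard (ω N)} from hg)]
    exact_mod_cast (hω N).2
  · rw [Set.indicator_of_notMem (show ω ∉ {ω | P.toProbProgram.Guard (ω N)} from hg)]
    rw [guard_iff, not_lt] at hg
    exact_mod_cast hg

/-- If `x₀ + μ E[min T N]` stays bounded away from `0`, the run is too likely to survive for the
expected runtime to be finite: the bound must come from runs that have not terminated, whose value
is at most linear in `N`. -/
lemma rt_eq_top_of_le (hp : P.p' = 0) {x₀ : Fin r → ℤ} (hx : 0 < P.rdwMap x₀) {δ : ℝ} (hδ : 0 < δ)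
    (h : ∀ N, δ ≤ P.rdwMap x₀
      + P.rdw.drift * ∑ n ∈ Finset.range N, P.toProbProgram.survival x₀ n) :
    P.toProbProgram.rt x₀ = ⊤ :=
  P.toProbProgram.rt_eq_top_of_le_mul_survival (A := P.rdwMap x₀) (B := P.m)
    (by exact_mod_cast hx.le) (by positivity) hδ
    fun N => (h N).trans (P.rdwMap_add_drift_mul_sum_le hp hx N)

lemma rt_eq_top_of_drift_nonneg (hp : P.p' = 0) (hμ : 0 ≤ P.rdw.drift) {x₀ : Fin r → ℤ}
    (hx : 0 < P.rdwMap x₀) : P.toProbProgram.rt x₀ = ⊤ :=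
  P.rt_eq_top_of_le hp hx (δ := P.rdwMap x₀) (by exact_mod_cast hx) fun N =>
    le_add_of_nonneg_right
      (mul_nonneg hμ (Finset.sum_nonneg fun n _ => P.toProbProgram.survival_nonneg x₀ n))

lemma rt_le (hp : P.p' = 0) (hμ : P.rdw.drift < 0) {x₀ : Fin r → ℤ} (hx : 0 < P.rdwMap x₀) :
    P.toProbProgram.rt x₀ ≤ ENNReal.ofReal
      (-(1 / P.rdw.drift) * (P.rdwMap x₀ : ℝ) + (1 - (P.k : ℝ)) / P.rdw.drift) := by
  rw [ProbProgram.rt_eq_tsum_survival]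
  refine ENNReal.tsum_le_of_sum_range_le fun N => ?_
  rw [← ENNReal.ofReal_sum_of_nonneg fun n _ => P.toProbProgram.survival_nonneg x₀ n]
  refine ENNReal.ofReal_le_ofReal ?_
  have h := P.le_rdwMap_add_drift_mul_sum hp hx N
  have heq : -(1 / P.rdw.drift) * (P.rdwMap x₀ : ℝ) + (1 - (P.k : ℝ)) / P.rdw.drift
      = (1 - (P.k : ℝ) - P.rdwMap x₀) / P.rdw.drift := by ring
  rw [heq, le_div_iff_of_neg hμ]
  linarith

lemma le_rt (hp : P.p' = 0) (hμ : P.rdw.drift < 0) {x₀ : Fin r → ℤ} (hx : 0 < P.rdwMap x₀) :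
    ENNReal.ofReal (-(1 / P.rdw.drift) * (P.rdwMap x₀ : ℝ)) ≤ P.toProbProgram.rt x₀ := by
  -- Otherwise `δ = x₀ + μ * rt` is positive, and `x₀ + μ E[min T N] ≥ δ` for all `N`.
  by_contra! hlt
  have hfin : P.toProbProgram.rt x₀ ≠ ⊤ := hlt.ne_top
  have hsum := hfin
  rw [ProbProgram.rt_eq_tsum_survival] at hsum hlt
  have hs := ENNReal.summable_toReal hsum
  simp only [ENNReal.toReal_ofReal (P.toProbProgram.survival_nonneg x₀ _)] at hs
  rw [← ENNReal.ofReal_tsum_of_nonneg (P.toProbProgram.survival_nonneg x₀) hs,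
    ENNReal.ofReal_lt_ofReal_iff_of_nonneg
      (tsum_nonneg (P.toProbProgram.survival_nonneg x₀))] at hlt
  have heq : -(1 / P.rdw.drift) * (P.rdwMap x₀ : ℝ) = (-P.rdwMap x₀ : ℝ) / P.rdw.drift := by ring
  rw [heq, lt_div_iff_of_neg hμ] at hlt
  refine hfin (P.rt_eq_top_of_le hp hx
    (δ := P.rdwMap x₀ + P.rdw.drift * ∑' n, P.toProbProgram.survival x₀ n) (by linarith)
    fun N => ?_)
  have := mul_le_mul_of_nonpos_left
    (hs.sum_le_tsum (Finset.range N) fun n _ => P.toProbProgram.survival_nonneg x₀ n) hμ.le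
  linarith

lemma rt_isTheta (hp : P.p' = 0) (hμ : P.rdw.drift < 0) :
    (fun x₀ : Fin r → ℤ => (P.toProbProgram.rt x₀).toReal)
      =Θ[𝓟 {x₀ | 0 < P.rdwMap x₀}] (fun x₀ => (P.rdwMap x₀ : ℝ)) := by
  have hinv : 0 < -(1 / P.rdw.drift) := neg_pos.2 (one_div_neg.2 hμ)
  refine ⟨IsBigO.of_bound (-(1 / P.rdw.drift) * (1 + P.k)) (eventually_principal.2 fun x hx => ?_),
    IsBigO.of_bound (-P.rdw.drift) (eventually_principal.2 fun x hx => ?_)⟩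
  all_goals
    have hx1 : (1 : ℝ) ≤ P.rdwMap x := by exact_mod_cast Int.add_one_le_of_lt hx
    rw [Real.norm_of_nonneg ENNReal.toReal_nonneg, Real.norm_of_nonneg (by linarith)]
  · have heq : -(1 / P.rdw.drift) * (P.rdwMap x : ℝ) + (1 - (P.k : ℝ)) / P.rdw.drift
        = -(1 / P.rdw.drift) * (P.rdwMap x + (P.k - 1)) := by ring
    have hle : (P.rdwMap x : ℝ) + (P.k - 1) ≤ (1 + P.k) * P.rdwMap x := by
      nlinarith [(Nat.cast_nonneg P.k : (0 : ℝ) ≤ P.k)]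
    have hk : (0 : ℝ) ≤ P.k := P.k.cast_nonneg
    refine (ENNReal.toReal_mono ENNReal.ofReal_ne_top (P.rt_le hp hμ hx)).trans ?_
    rw [heq, ENNReal.toReal_ofReal (mul_nonneg hinv.le (by linarith)), mul_assoc]
    exact mul_le_mul_of_nonneg_left hle hinv.le
  · have hfin : P.toProbProgram.rt x ≠ ⊤ :=
      ((P.rt_le hp hμ hx).trans_lt ENNReal.ofReal_lt_top).ne
    have h := (ENNReal.ofReal_le_iff_le_toReal hfin).1 (P.le_rt hp hμ hx)
    calc (P.rdwMap x : ℝ) = -P.rdw.drift * (-(1 / P.rdw.drift) * P.rdwMap x) := by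
          field_simp [hμ.ne]
      _ ≤ _ := mul_le_mul_of_nonneg_left h (by linarith)

end CPProgram

theorem mainTheorem2 {r : ℕ} (P : CPProgram r) (hnontriv : ¬ P.IsTrivial)
    (hdirect : ¬ P.toProbProgram.DirectTermination) :
    (P.toProbProgram.IsPAST ↔ P.rdw.drift < 0) ∧
    (P.rdw.drift < 0 →
      (∀ x₀ : Fin r → ℤ, P.rdwMap x₀ ≤ 0 → P.toProbProgram.rt x₀ = 0) ∧
      (∀ x₀ : Fin r → ℤ, 0 < P.rdwMap x₀ →
        ENNReal.ofReal (-(1 / P.rdw.drift) * (P.rdwMap x₀ : ℝ)) ≤ P.toProbProgram.rt x₀ ∧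
        P.toProbProgram.rt x₀ ≤
          ENNReal.ofReal (-(1 / P.rdw.drift) * (P.rdwMap x₀ : ℝ)
            + (1 - (P.k : ℝ)) / P.rdw.drift)) ∧
      (fun x₀ : Fin r → ℤ => (P.toProbProgram.rt x₀).toReal)
        =Θ[𝓟 {x₀ | 0 < P.rdwMap x₀}] (fun x₀ => (P.rdwMap x₀ : ℝ))) := by
  have ha : P.a ≠ 0 := fun h => hnontriv (Or.inl h)
  have hp := P.p'_eq_zero ha hdirect
  have hzero : ∀ x₀ : Fin r → ℤ, P.rdwMap x₀ ≤ 0 → P.toProbProgram.rt x₀ = 0 := fun x₀ hx =>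
    P.toProbProgram.rt_eq_zero fun h => hx.not_gt ((P.guard_iff x₀).1 h)
  refine ⟨⟨fun hpast => ?_, fun hμ x₀ => ?_⟩, fun hμ =>
    ⟨hzero, fun x₀ hx => ⟨P.le_rt hp hμ hx, P.rt_le hp hμ hx⟩, P.rt_isTheta hp hμ⟩⟩
  · by_contra! hμ
    obtain ⟨z, hz⟩ := P.exists_rdwMap_pos ha
    exact (hpast z).ne (P.rt_eq_top_of_drift_nonneg hp hμ hz)
  · rcases le_or_gt (P.rdwMap x₀) 0 with hx | hx
    · rw [hzero x₀ hx]
      exact ENNReal.zero_lt_top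
    · exact (P.rt_le hp hμ hx).trans_lt ENNReal.ofReal_lt_top
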